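/- A complex unit gain graph $\Phi=(G,\varphi)$ is a finite simple graph $G$ together with a map $\varphi$ assigning to each oriented edge $(u,v)$ of $G$ a complex number of modulus $1$, with $\varphi(v,u)=\varphi(u,v)^{-1}$. Its adjacency matrix $A(\Phi)$ is the Hermitian matrix with entries $\varphi(u,v)$ for $u\sim v$ and $0$ otherwise, and its energy $E(\Phi)$ is the sum of the absolute values of the eigenvalues of $A(\Phi)$, counted with multiplicity. The gain of an oriented cycle is the product of the gains of its oriented edges. For integers $r,s\ge 3$ and $\ell\ge 1$, the dumbbell graph $D_{r,s,\ell}$ consists of two vertex-disjoint cycles $C_r$ and $C_s$ (of lengths $r$ and $s$), with one vertex of $C_r$ joined to one vertex of $C_s$ by a path of length $\ell$. **Theorem.** Let $r,s\ge 3$ and $\ell\ge 1$ be integers with $r$ and $s$ even. For a complex unit gain graph $\Phi$ on $D_{r,s,\ell}$, let $\gamma_r$ and $\gamma_s$ be the gains of $C_r$ and $C_s$ (each traversed in a fixed direction), and put $\alpha=(-1)^{r/2}\operatorname{Re}\gamma_r$ and $\beta=(-1)^{s/2}\operatorname{Re}\gamma_s$. Among all complex unit gain graphs $\Phi$ on $D_{r,s,\ell}$,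 the minimum of $E(\Phi)$ is attained, exactly by those $\Phi$ with $(\alpha,\beta)=(1,1)$, and the maximum of $E(\Phi)$ is attained, exactly by those $\Phi$ with $(\alpha,\beta)=(-1,-1)$. **Corollary.** Under the same assumptions: (a) if $r\equiv s\equiv 0\pmod 4$, the minimum is attained exactly at $(\gamma_r,\gamma_s)=(1,1)$ and the maximum exactly at $(-1,-1)$; (b) if $r\equiv s\equiv 2\pmod 4$, the minimum is attained exactly at $(\gamma_r,\gamma_s)=(-1,-1)$ and the maximum exactly at $(1,1)$; (c) if $r\equiv 0$ and $s\equiv 2\pmod 4$, the minimum is attained exactly at $(\gamma_r,\gamma_s)=(1,-1)$ and the maximum exactly at $(-1,1)$; (d) if $r\equiv 2$ and $s\equiv 0\pmod 4$, the minimum is attained exactly at $(\gamma_r,\gamma_s)=(-1,1)$ and the maximum exactly at $(1,-1)$. -/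

import Mathlib

/-- A complex unit gain graph with underlying simple graph `G`: each oriented edge (dart) carries a
unit complex number, and reversing the orientation inverts the gain. -/
structure UnitGainGraph {V : Type*} (G : SimpleGraph V) where
  gain : G.Dart → Circle
  gain_symm : ∀ d : G.Dart, gain d.symm = (gain d)⁻¹

namespace UnitGainGraph

variable {V : Type*} {G : SimpleGraph V}

open Classical in
/-- The Hermitian adjacency matrix: the gain of `(u, v)` if `u` and `v` are adjacent, else `0`. -/
noncomputable def adjMatrix (Φ : UnitGainGraph G) : Matrix V V ℂ :=
  fun u v => if h : G.Adj u v then (Φ.gain ⟨(u, v), h⟩ : ℂ) else 0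

theorem adjMatrix_isHermitian (Φ : UnitGainGraph G) : Φ.adjMatrix.IsHermitian := by
  ext u v
  rw [Matrix.conjTranspose_apply]
  unfold adjMatrix
  by_cases h : G.Adj u v
  · have h2 := Φ.gain_symm ⟨(u, v), h⟩
    rw [dif_pos h, dif_pos h.symm]
    change star ((Φ.gain (SimpleGraph.Dart.symm ⟨(u, v), h⟩) : Circle) : ℂ) = _
    rw [h2, Circle.coe_inv_eq_conj]
    simp
  · rw [dif_neg h, dif_neg (fun h' => h h'.symm)]
    simp

/-- The energy: the sum of the absolute values of the eigenvalues of the adjacency matrix,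
counted with multiplicity. -/
noncomputable def energy [Fintype V] [DecidableEq V] (Φ : UnitGainGraph G) : ℝ :=
  ∑ j, |Φ.adjMatrix_isHermitian.eigenvalues j|

end UnitGainGraph

theorem cycleGraph_adj_finRotate {n : ℕ} (hn : 3 ≤ n) (i : Fin n) :
    (SimpleGraph.cycleGraph n).Adj i (finRotate n i) := by
  obtain ⟨m, rfl⟩ : ∃ m, n = m + 2 := ⟨n - 2, by omega⟩
  rw [SimpleGraph.cycleGraph_adj, finRotate_apply]
  right
  simp

/-- The gain of the cycle `c 0, c 1, …, c (n - 1), c 0`, the image of the `n`-cycle under `c`: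
the product of the gains of the oriented edges `(c i, c (i + 1))`, indices mod `n`. -/
noncomputable def UnitGainGraph.cycleGain {V : Type*} {G : SimpleGraph V} (Φ : UnitGainGraph G)
    {n : ℕ} (hn : 3 ≤ n) (c : SimpleGraph.cycleGraph n →g G) : Circle :=
  ∏ i : Fin n,
    Φ.gain ⟨(c i, c (finRotate n i)), c.map_adj (cycleGraph_adj_finRotate hn i)⟩

/-- The edges attaching the `ℓ - 1` inner vertices of the joining path (the last summand) to vertex
`0` of the first cycle and to vertex `0` of the second; if `ℓ = 1` there is no inner vertex, and the
path is the single edge between these two vertices. -/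
def dumbbellLink (r s ℓ : ℕ) :
    (Fin r ⊕ Fin s) ⊕ Fin (ℓ - 1) → (Fin r ⊕ Fin s) ⊕ Fin (ℓ - 1) → Prop
  | .inl (.inl i), .inr p => i.val = 0 ∧ p.val = 0
  | .inr p, .inl (.inr j) => p.val + 2 = ℓ ∧ j.val = 0
  | .inl (.inl i), .inl (.inr j) => ℓ = 1 ∧ i.val = 0 ∧ j.val = 0
  | _, _ => False

/-- The dumbbell graph `D_{r,s,ℓ}` (for `3 ≤ r`, `3 ≤ s`, `1 ≤ ℓ`): two disjoint cycles of lengths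
`r` and `s`, a vertex of the one joined to a vertex of the other by a path of length `ℓ`. -/
def dumbbellGraph (r s ℓ : ℕ) : SimpleGraph ((Fin r ⊕ Fin s) ⊕ Fin (ℓ - 1)) :=
  SimpleGraph.sum (SimpleGraph.sum (SimpleGraph.cycleGraph r) (SimpleGraph.cycleGraph s))
      (SimpleGraph.pathGraph (ℓ - 1)) ⊔
    SimpleGraph.fromRel (dumbbellLink r s ℓ)

/-- The cycle `C_r` of the dumbbell graph. -/
def dumbbellCycleLeft (r s ℓ : ℕ) : SimpleGraph.cycleGraph r →g dumbbellGraph r s ℓ where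
  toFun i := .inl (.inl i)
  map_rel' h := Or.inl h

/-- The cycle `C_s` of the dumbbell graph. -/
def dumbbellCycleRight (r s ℓ : ℕ) : SimpleGraph.cycleGraph s →g dumbbellGraph r s ℓ where
  toFun j := .inl (.inr j)
  map_rel' h := Or.inl h

/-- The gain `γ_r` of the cycle `C_r` in a gain graph on `D_{r,s,ℓ}`. -/
noncomputable def gammaLeft {r s ℓ : ℕ} (hr : 3 ≤ r) (Φ : UnitGainGraph (dumbbellGraph r s ℓ)) :
    ℂ :=
  (Φ.cycleGain hr (dumbbellCycleLeft r s ℓ) : ℂ)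

/-- The gain `γ_s` of the cycle `C_s` in a gain graph on `D_{r,s,ℓ}`. -/
noncomputable def gammaRight {r s ℓ : ℕ} (hs : 3 ≤ s) (Φ : UnitGainGraph (dumbbellGraph r s ℓ)) :
    ℂ :=
  (Φ.cycleGain hs (dumbbellCycleRight r s ℓ) : ℂ)

/-- `α = (-1)^{r/2} Re γ_r`, for even `r`. -/
noncomputable def alphaParam {r s ℓ : ℕ} (hr : 3 ≤ r) (Φ : UnitGainGraph (dumbbellGraph r s ℓ)) :
    ℝ :=
  (-1) ^ (r / 2) * (gammaLeft hr Φ).re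

/-- `β = (-1)^{s/2} Re γ_s`, for even `s`. -/
noncomputable def betaParam {r s ℓ : ℕ} (hs : 3 ≤ s) (Φ : UnitGainGraph (dumbbellGraph r s ℓ)) :
    ℝ :=
  (-1) ^ (s / 2) * (gammaRight hs Φ).re

/-- `Φ` has minimum energy among all complex unit gain graphs with the same underlying graph. -/
def IsMinEnergy {V : Type*} [Fintype V] [DecidableEq V] {G : SimpleGraph V}
    (Φ : UnitGainGraph G) : Prop :=
  ∀ Ψ : UnitGainGraph G, Φ.energy ≤ Ψ.energy

/-- `Φ` has maximum energy among all complex unit gain graphs with the same underlying graph. -/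
def IsMaxEnergy {V : Type*} [Fintype V] [DecidableEq V] {G : SimpleGraph V}
    (Φ : UnitGainGraph G) : Prop :=
  ∀ Ψ : UnitGainGraph G, Ψ.energy ≤ Φ.energy

/-! ### Coulson-type comparison of energies -/

section EnergyComparison

open MeasureTheory Set

/-! The energy is strictly decreasing in `α` and in `β`, and both lie in `[-1, 1]`; the extrema
therefore sit at the corners `(1, 1)` and `(-1, -1)`.

Coulson's method reduces energies to determinants. Up to a positive constant, `∑ |λ_j|` is the
integral over `t > 0` of `∑ log (1 + λ_j² / t²)`, and `∏ (t² + λ_j²) = |det (t + iA)|²`. A pointwise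
inequality between these determinants thus gives the inequality between energies
(`energy_le_of_norm_det_le`, `energy_lt_of_norm_det_lt`).

In `t + iA` opposite entries on an edge have product `i² = -1`, whatever the gain. So an induced
path contributes a continuant `K` with plus signs only, positive and increasing in its diagonal.
Eliminating each cycle except its base vertex by a Schur complement leaves the joining path. The
gains survive only as a weight added to `t` at each end, `(2 K_{r-2} - 2α) / K_{r-1}` and its
analogue with `s` and `β` (`cycle_coupling`). Hence `det (t + iA)` is `K_{r-1} K_{s-1}` times the
continuant of the weighted path (`det_shiftMatrix_dumbbell`). For even `r` one has `K_{r-2} ≥ 1 ≥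
α`, so the weights are nonnegative; they decrease strictly in the parameters, and so does the
determinant. -/

theorem integrableOn_log_one_add_inv_sq :
    IntegrableOn (fun t : ℝ => Real.log (1 + t⁻¹ ^ 2)) (Ioi 0) := by
  -- Near `0` the singularity is that of `-2 log t`; beyond `1` the bound `log (1 + x) ≤ x` gives
  -- domination by `t⁻²`.
  rw [← Ioc_union_Ioi_eq_Ioi (zero_le_one' ℝ)]
  refine IntegrableOn.union ?_ ?_
  · have h1 : IntegrableOn (fun t : ℝ => Real.log (1 + t ^ 2) - 2 * Real.log t) (Ioc 0 1) := by
      rw [← intervalIntegrable_iff_integrableOn_Ioc_of_le zero_le_one]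
      refine IntervalIntegrable.sub (Continuous.intervalIntegrable ?_ _ _)
        (intervalIntegral.intervalIntegrable_log'.const_mul 2)
      exact Continuous.log (by fun_prop) fun t => by positivity
    refine h1.congr_fun (fun t ht => ?_) measurableSet_Ioc
    have ht0 : 0 < t := ht.1
    have h2 : 1 + t⁻¹ ^ 2 = (1 + t ^ 2) / t ^ 2 := by field_simp; ring
    simp only
    rw [h2, Real.log_div (by positivity) (by positivity), Real.log_pow]
    norm_num
  · have h1 : IntegrableOn (fun t : ℝ => t ^ (-2 : ℝ)) (Ioi 1) :=
      integrableOn_Ioi_rpow_of_lt (by norm_num) one_pos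
    refine Integrable.mono' h1 ?_ ?_
    · exact (Measurable.log (by fun_prop)).aestronglyMeasurable
    · refine (ae_restrict_iff' measurableSet_Ioi).2 (.of_forall fun t ht => ?_)
      have ht0 : 0 < t := lt_trans one_pos ht
      have hpos : (0 : ℝ) ≤ t⁻¹ ^ 2 := by positivity
      rw [Real.norm_of_nonneg (Real.log_nonneg (by linarith)), Real.rpow_neg ht0.le]
      have h3 := Real.log_le_sub_one_of_pos (show (0 : ℝ) < 1 + t⁻¹ ^ 2 by positivity)
      have h4 : t⁻¹ ^ 2 = (t ^ (2 : ℝ))⁻¹ := by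
        rw [inv_pow]; norm_cast
      linarith

theorem integrableOn_log_one_add_div_sq (a : ℝ) :
    IntegrableOn (fun t : ℝ => Real.log (1 + (a / t) ^ 2)) (Ioi 0) := by
  rcases eq_or_ne a 0 with rfl | ha
  · simp
  · have h := (integrableOn_Ioi_comp_mul_left_iff (fun t : ℝ => Real.log (1 + t⁻¹ ^ 2)) 0
      (inv_pos.2 (abs_pos.2 ha))).2 (by simpa using integrableOn_log_one_add_inv_sq)
    refine h.congr_fun (fun t _ => ?_) measurableSet_Ioi
    simp [mul_pow, div_eq_mul_inv, mul_comm]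

/-- Substitution `t = |a| u`. Only the positivity of the remaining constant matters later, not its
value. -/
theorem integral_log_one_add_div_sq (a : ℝ) :
    ∫ t in Ioi (0 : ℝ), Real.log (1 + (a / t) ^ 2) =
      |a| * ∫ t in Ioi (0 : ℝ), Real.log (1 + t⁻¹ ^ 2) := by
  rcases eq_or_ne a 0 with rfl | ha
  · simp
  · have h := integral_comp_mul_left_Ioi (fun t : ℝ => Real.log (1 + t⁻¹ ^ 2)) 0
      (inv_pos.2 (abs_pos.2 ha))
    rw [mul_zero, inv_inv, smul_eq_mul] at h
    rw [← h]
    refine setIntegral_congr_fun measurableSet_Ioi (fun t _ => ?_)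
    simp [mul_pow, div_eq_mul_inv, mul_comm]

section Comparison

variable {ι : Type*} [Fintype ι]

/-- The subtracted term depends only on the number of indices, so it cancels when two families are
compared. -/
theorem sum_log_one_add_div_sq (a : ι → ℝ) {t : ℝ} (ht : 0 < t) :
    ∑ j, Real.log (1 + (a j / t) ^ 2) =
      Real.log (∏ j, (t ^ 2 + a j ^ 2)) - Fintype.card ι * Real.log (t ^ 2) := by
  have h (j : ι) : Real.log (1 + (a j / t) ^ 2) =
      Real.log (t ^ 2 + a j ^ 2) - Real.log (t ^ 2) := by
    rw [← Real.log_div (by positivity) (by positivity)]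
    congr 1
    field_simp
  simp_rw [h]
  rw [Finset.sum_sub_distrib, Real.log_prod (fun j _ => by positivity)]
  simp

theorem integrableOn_sum_log (a : ι → ℝ) :
    IntegrableOn (fun t : ℝ => ∑ j, Real.log (1 + (a j / t) ^ 2)) (Ioi 0) :=
  integrable_finsetSum _ fun j _ => integrableOn_log_one_add_div_sq (a j)

theorem integral_sum_log (a : ι → ℝ) :
    ∫ t in Ioi (0 : ℝ), ∑ j, Real.log (1 + (a j / t) ^ 2) =
      (∑ j, |a j|) * ∫ t in Ioi (0 : ℝ), Real.log (1 + t⁻¹ ^ 2) := by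
  rw [integral_finsetSum _ fun j _ => integrableOn_log_one_add_div_sq (a j), Finset.sum_mul]
  exact Finset.sum_congr rfl fun j _ => integral_log_one_add_div_sq (a j)

theorem integral_log_one_add_inv_sq_pos :
    0 < ∫ t in Ioi (0 : ℝ), Real.log (1 + t⁻¹ ^ 2) := by
  have hpos : ∀ t ∈ Ioi (0 : ℝ), 0 < Real.log (1 + t⁻¹ ^ 2) := fun t ht => by
    have ht' : 0 < t := ht
    have : 0 < t⁻¹ ^ 2 := by positivity
    exact Real.log_pos (by linarith)
  rw [setIntegral_pos_iff_support_of_nonneg_ae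
    ((ae_restrict_iff' measurableSet_Ioi).2 (.of_forall fun t ht => (hpos t ht).le))
    integrableOn_log_one_add_inv_sq]
  rw [inter_eq_right.2 fun t ht => Function.mem_support.2 (hpos t ht).ne']
  simp

/-- Comparison of `ℓ¹`-norms through the polynomials `∏ (t² + a_j²)`, after Coulson. -/
theorem sum_abs_le_of_prod_le {a b : ι → ℝ}
    (h : ∀ t : ℝ, 0 < t → ∏ j, (t ^ 2 + a j ^ 2) ≤ ∏ j, (t ^ 2 + b j ^ 2)) :
    ∑ j, |a j| ≤ ∑ j, |b j| := by
  refine le_of_mul_le_mul_right ?_ integral_log_one_add_inv_sq_pos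
  rw [← integral_sum_log, ← integral_sum_log]
  refine setIntegral_mono_on (integrableOn_sum_log a) (integrableOn_sum_log b) measurableSet_Ioi
    fun t ht => ?_
  have ht' : 0 < t := ht
  rw [sum_log_one_add_div_sq a ht, sum_log_one_add_div_sq b ht]
  exact sub_le_sub_right (Real.log_le_log (Finset.prod_pos fun j _ => by positivity) (h t ht)) _

/-- The difference of the integrands is positive on the whole half-line, so its integral is
positive. -/
theorem sum_abs_lt_of_prod_lt {a b : ι → ℝ}
    (h : ∀ t : ℝ, 0 < t → ∏ j, (t ^ 2 + a j ^ 2) < ∏ j, (t ^ 2 + b j ^ 2)) :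
    ∑ j, |a j| < ∑ j, |b j| := by
  refine lt_of_mul_lt_mul_right ?_ integral_log_one_add_inv_sq_pos.le
  rw [← integral_sum_log, ← integral_sum_log, ← sub_pos,
    ← integral_sub (integrableOn_sum_log b) (integrableOn_sum_log a)]
  have hpos : ∀ t ∈ Ioi (0 : ℝ),
      0 < ∑ j, Real.log (1 + (b j / t) ^ 2) - ∑ j, Real.log (1 + (a j / t) ^ 2) := fun t ht => by
    have ht' : 0 < t := ht
    rw [sum_log_one_add_div_sq a ht, sum_log_one_add_div_sq b ht, sub_sub_sub_cancel_right, sub_pos]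
    exact Real.log_lt_log (Finset.prod_pos fun j _ => by positivity) (h t ht)
  rw [setIntegral_pos_iff_support_of_nonneg_ae
    ((ae_restrict_iff' measurableSet_Ioi).2 (.of_forall fun t ht => (hpos t ht).le))
    ((integrableOn_sum_log b).sub (integrableOn_sum_log a))]
  rw [inter_eq_right.2 fun t ht => Function.mem_support.2 (hpos t ht).ne']
  simp

end Comparison

namespace Matrix.IsHermitian

variable {n : Type*} [Fintype n] [DecidableEq n] {A : Matrix n n ℂ}

/-- Since `t + iA = -i (it - A)`, the determinant has the modulus of the characteristic polynomial
at `it`, and `|it - λ|² = t² + λ²` for real `λ`. -/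
theorem norm_det_scalar_add_I_smul_sq (hA : A.IsHermitian) (t : ℝ) :
    ‖((t : ℂ) • (1 : Matrix n n ℂ) + Complex.I • A).det‖ ^ 2 =
      ∏ j, (t ^ 2 + hA.eigenvalues j ^ 2) := by
  have h1 : (t : ℂ) • (1 : Matrix n n ℂ) + Complex.I • A =
      (-Complex.I) • (scalar n (Complex.I * t) - A) := by
    ext i j
    by_cases hij : i = j
    · subst hij
      simp
      linear_combination (t : ℂ) * Complex.I_sq
    · simp [hij]
  rw [h1, det_smul, ← eval_charpoly, hA.charpoly_eq, Polynomial.eval_prod, norm_mul, norm_pow,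
    norm_neg, Complex.norm_I, one_pow, one_mul, norm_prod, ← Finset.prod_pow]
  refine Finset.prod_congr rfl fun j _ => ?_
  rw [Complex.sq_norm, Complex.normSq_apply]
  simp
  ring

end Matrix.IsHermitian

namespace UnitGainGraph

variable {V : Type*} [DecidableEq V] {G : SimpleGraph V}

/-- The matrix `t + i A(Φ)`. -/
noncomputable def shiftMatrix (Φ : UnitGainGraph G) (t : ℝ) : Matrix V V ℂ :=
  (t : ℂ) • (1 : Matrix V V ℂ) + Complex.I • Φ.adjMatrix

theorem shiftMatrix_self (Φ : UnitGainGraph G) (t : ℝ) (u : V) : Φ.shiftMatrix t u u = t := by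
  simp [shiftMatrix, adjMatrix]

theorem shiftMatrix_of_adj (Φ : UnitGainGraph G) (t : ℝ) {u v : V} (h : G.Adj u v) :
    Φ.shiftMatrix t u v = Complex.I * Φ.gain ⟨(u, v), h⟩ := by
  simp [shiftMatrix, adjMatrix, h, h.ne]

theorem shiftMatrix_of_not_adj (Φ : UnitGainGraph G) (t : ℝ) {u v : V} (hne : u ≠ v)
    (h : ¬ G.Adj u v) : Φ.shiftMatrix t u v = 0 := by
  simp [shiftMatrix, adjMatrix, h, hne]

theorem shiftMatrix_of_adj' (Φ : UnitGainGraph G) (t : ℝ) {u v : V} (h : G.Adj u v) :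
    Φ.shiftMatrix t v u = Complex.I * starRingEnd ℂ (Φ.gain ⟨(u, v), h⟩ : ℂ) := by
  have h2 := Φ.gain_symm ⟨(u, v), h⟩
  rw [Φ.shiftMatrix_of_adj t h.symm, ← Circle.coe_inv_eq_conj, ← h2]
  rfl

/-- The gain and its conjugate cancel: this is why determinants along paths do not see the gains. -/
theorem shiftMatrix_mul_symm (Φ : UnitGainGraph G) (t : ℝ) {u v : V} (h : G.Adj u v) :
    Φ.shiftMatrix t u v * Φ.shiftMatrix t v u = -1 := by
  rw [Φ.shiftMatrix_of_adj' t h, Φ.shiftMatrix_of_adj t h, mul_mul_mul_comm, Complex.I_mul_I,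
    Complex.mul_conj]
  simp

variable [Fintype V]

theorem energy_le_of_norm_det_le {Φ Ψ : UnitGainGraph G}
    (h : ∀ t : ℝ, 0 < t → ‖(Φ.shiftMatrix t).det‖ ≤ ‖(Ψ.shiftMatrix t).det‖) :
    Φ.energy ≤ Ψ.energy :=
  sum_abs_le_of_prod_le fun t ht => by
    rw [← Φ.adjMatrix_isHermitian.norm_det_scalar_add_I_smul_sq,
      ← Ψ.adjMatrix_isHermitian.norm_det_scalar_add_I_smul_sq]
    exact pow_le_pow_left₀ (norm_nonneg _) (h t ht) 2

theorem energy_lt_of_norm_det_lt {Φ Ψ : UnitGainGraph G}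
    (h : ∀ t : ℝ, 0 < t → ‖(Φ.shiftMatrix t).det‖ < ‖(Ψ.shiftMatrix t).det‖) :
    Φ.energy < Ψ.energy :=
  sum_abs_lt_of_prod_lt fun t ht => by
    rw [← Φ.adjMatrix_isHermitian.norm_det_scalar_add_I_smul_sq,
      ← Ψ.adjMatrix_isHermitian.norm_det_scalar_add_I_smul_sq]
    exact pow_lt_pow_left₀ (h t ht) (norm_nonneg _) two_ne_zero

end UnitGainGraph

end EnergyComparison

/-! ### Continuants, tridiagonal determinants and Schur complements -/

/-- The continuant with diagonal `d 0, …, d (n - 1)`: the determinant of a tridiagonal matrix with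
this diagonal in which the products of opposite off-diagonal entries are `-1`. -/
def continuant : ℕ → (ℕ → ℝ) → ℝ
  | 0, _ => 1
  | 1, d => d 0
  | n + 2, d => d 0 * continuant (n + 1) (fun i => d (i + 1)) + continuant n (fun i => d (i + 2))

theorem continuant_pos : ∀ (n : ℕ) {d : ℕ → ℝ}, (∀ i, 0 < d i) → 0 < continuant n d
  | 0, _, _ => one_pos
  | 1, _, hd => hd 0
  | n + 2, _, hd => add_pos (mul_pos (hd 0) (continuant_pos (n + 1) fun i => hd (i + 1)))
      (continuant_pos n fun i => hd (i + 2))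

theorem continuant_mono : ∀ (n : ℕ) {d e : ℕ → ℝ}, (∀ i, 0 < d i) → (∀ i, d i ≤ e i) →
    continuant n d ≤ continuant n e
  | 0, _, _, _, _ => le_rfl
  | 1, _, _, _, h => h 0
  | n + 2, _, _, hd, h => add_le_add
      (mul_le_mul (h 0) (continuant_mono (n + 1) (fun i => hd (i + 1)) fun i => h (i + 1))
        (continuant_pos (n + 1) fun i => hd (i + 1)).le ((hd 0).le.trans (h 0)))
      (continuant_mono n (fun i => hd (i + 2)) fun i => h (i + 2))

/-- The recursion has no minus signs, and along it each `d k` gets multiplied by a positive factor;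
one strict increase suffices. -/
theorem continuant_lt : ∀ (n : ℕ) {d e : ℕ → ℝ}, (∀ i, 0 < d i) → (∀ i, d i ≤ e i) →
    ∀ k < n, d k < e k → continuant n d < continuant n e
  | 0, _, _, _, _, _, hk, _ => absurd hk (Nat.not_lt_zero _)
  | 1, d, e, _, _, k, hk, h => by
      obtain rfl : k = 0 := by omega
      exact h
  | n + 2, d, e, hd, h, 0, _, hlt => add_lt_add_of_lt_of_le
      (mul_lt_mul hlt (continuant_mono (n + 1) (fun i => hd (i + 1)) fun i => h (i + 1))
        (continuant_pos (n + 1) fun i => hd (i + 1)) ((hd 0).le.trans (h 0)))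
      (continuant_mono n (fun i => hd (i + 2)) fun i => h (i + 2))
  | n + 2, d, e, hd, h, k + 1, hk, hlt => add_lt_add_of_lt_of_le
      (mul_lt_mul' (h 0) (continuant_lt (n + 1) (fun i => hd (i + 1)) (fun i => h (i + 1)) k
        (by omega) hlt) (continuant_pos (n + 1) fun i => hd (i + 1)).le ((hd 0).trans_le (h 0)))
      (continuant_mono n (fun i => hd (i + 2)) fun i => h (i + 2))

/-- For even `n`, the second summand of the recursion leads down to `continuant 0 = 1`, and all
other terms are positive. This makes the cycle weights nonnegative. -/
theorem one_le_continuant : ∀ (n : ℕ) {d : ℕ → ℝ}, (∀ i, 0 < d i) → Even n → 1 ≤ continuant n d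
  | 0, _, _, _ => le_rfl
  | 1, _, _, h => absurd h (by decide)
  | n + 2, d, hd, h => by
      have h1 := one_le_continuant n (fun i => hd (i + 2)) (by simpa [Nat.even_add] using h)
      have h2 := mul_pos (hd 0) (continuant_pos (n + 1) fun i => hd (i + 1))
      change 1 ≤ d 0 * continuant (n + 1) (fun i => d (i + 1)) + continuant n (fun i => d (i + 2))
      linarith

namespace Matrix

/-- Tridiagonal matrices with real diagonal `d` whose opposite off-diagonal entries have
product `-1`. -/
structure IsSkewTridiagonal {n : ℕ} (M : Matrix (Fin n) (Fin n) ℂ) (d : ℕ → ℝ) : Prop where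
  diag : ∀ i, M i i = d i
  mul : ∀ i j : Fin n, j.val = i.val + 1 → M i j * M j i = -1
  upper : ∀ i j : Fin n, i.val + 1 < j.val → M i j = 0
  lower : ∀ i j : Fin n, i.val + 1 < j.val → M j i = 0

namespace IsSkewTridiagonal

theorem submatrix_succ {n : ℕ} {M : Matrix (Fin (n + 1)) (Fin (n + 1)) ℂ} {d : ℕ → ℝ}
    (h : M.IsSkewTridiagonal d) :
    (M.submatrix Fin.succ Fin.succ).IsSkewTridiagonal fun i => d (i + 1) where
  diag i := by simp [h.diag]
  mul i j hij := h.mul _ _ (by simp [hij])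
  upper i j hij := h.upper _ _ (by simpa using hij)
  lower i j hij := h.lower _ _ (by simpa using hij)

theorem submatrix_castSucc {n : ℕ} {M : Matrix (Fin (n + 1)) (Fin (n + 1)) ℂ} {d : ℕ → ℝ}
    (h : M.IsSkewTridiagonal d) :
    (M.submatrix Fin.castSucc Fin.castSucc).IsSkewTridiagonal d where
  diag i := by simp [h.diag]
  mul i j hij := h.mul _ _ (by simp [hij])
  upper i j hij := h.upper _ _ (by simpa using hij)
  lower i j hij := h.lower _ _ (by simpa using hij)

theorem det_eq : ∀ {n : ℕ} {M : Matrix (Fin n) (Fin n) ℂ} {d : ℕ → ℝ},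
    M.IsSkewTridiagonal d → M.det = continuant n d
  | 0, M, d, _ => by simp [continuant]
  | 1, M, d, h => by simp [continuant, h.diag]
  | n + 2, M, d, h => by
    have h0 : ∀ i : Fin n, M 0 i.succ.succ = 0 := fun i => h.upper _ _ (by simp)
    have h0' : ∀ i : Fin n, M i.succ.succ 0 = 0 := fun i => h.lower _ _ (by simp)
    -- The first column of this minor has `M 1 0` as its only possibly nonzero entry.
    have h1 : (M.submatrix Fin.succ (Fin.succAbove 1)).det =
        M 1 0 * continuant n (fun i => d (i + 2)) := by
      rw [det_succ_column_zero, Fin.sum_univ_succ]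
      have : ((M.submatrix Fin.succ (Fin.succAbove 1)).submatrix (Fin.succAbove 0) Fin.succ) =
          (M.submatrix Fin.succ Fin.succ).submatrix Fin.succ Fin.succ := by
        ext i j
        simp [Fin.succAbove, Fin.lt_def]
      rw [this, h.submatrix_succ.submatrix_succ.det_eq]
      simp [h0', add_assoc]
    rw [det_succ_row_zero, Fin.sum_univ_succ, Fin.sum_univ_succ]
    have h2 : (M.submatrix Fin.succ (Fin.succAbove 0)) = M.submatrix Fin.succ Fin.succ := by
      simp [Fin.succAbove_zero]
    have h3 : M 0 1 * M 1 0 = -1 := h.mul _ _ (by simp)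
    rw [h2, h.submatrix_succ.det_eq]
    simp only [h0, Fin.succ_zero_eq_one, h1, h.diag, continuant]
    simp
    linear_combination (-(continuant n (fun i => d (i + 2)) : ℂ)) * h3

variable {n : ℕ} {M : Matrix (Fin (n + 1)) (Fin (n + 1)) ℂ} {d : ℕ → ℝ}

theorem adjugate_zero_zero (h : M.IsSkewTridiagonal d) :
    M.adjugate 0 0 = continuant n (fun i => d (i + 1)) := by
  rw [adjugate_fin_succ_eq_det_submatrix, Fin.succAbove_zero, h.submatrix_succ.det_eq]
  simp

theorem adjugate_last_last (h : M.IsSkewTridiagonal d) :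
    M.adjugate (Fin.last n) (Fin.last n) = continuant n d := by
  rw [adjugate_fin_succ_eq_det_submatrix, Fin.succAbove_last, h.submatrix_castSucc.det_eq,
    Even.neg_one_pow ⟨_, rfl⟩, one_mul]

/-- Deleting the last row and the first column leaves a triangular matrix whose diagonal is the
superdiagonal of `M`. -/
theorem adjugate_zero_last (h : M.IsSkewTridiagonal d) :
    M.adjugate 0 (Fin.last n) = (-1) ^ n * ∏ i : Fin n, M i.castSucc i.succ := by
  rw [adjugate_fin_succ_eq_det_submatrix, Fin.succAbove_last, Fin.succAbove_zero,
    det_of_isLowerTriangular]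
  · simp
  · intro i j hij
    exact h.upper _ _ (by simpa using hij)

theorem adjugate_last_zero (h : M.IsSkewTridiagonal d) :
    M.adjugate (Fin.last n) 0 = (-1) ^ n * ∏ i : Fin n, M i.succ i.castSucc := by
  rw [adjugate_fin_succ_eq_det_submatrix, Fin.succAbove_last, Fin.succAbove_zero,
    det_of_isUpperTriangular]
  · simp
  · intro i j hij
    exact h.lower _ _ (by simpa using hij)

theorem add_single_zero (h : M.IsSkewTridiagonal d) (x : ℝ) :
    (M + single 0 0 (x : ℂ)).IsSkewTridiagonal (d + Pi.single 0 x) where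
  diag i := by
    rcases eq_or_ne i 0 with rfl | hi
    · simp [h.diag]
    · simp [h.diag, hi, hi.symm]
  mul i j hij := by
    have hj : 0 ≠ j := fun e => by simp [← e] at hij
    simpa [hj] using h.mul i j hij
  upper i j hij := by
    have hj : 0 ≠ j := fun e => by simp [← e] at hij
    simpa [hj] using h.upper i j hij
  lower i j hij := by
    have hj : 0 ≠ j := fun e => by simp [← e] at hij
    simpa [hj] using h.lower i j hij

theorem add_single_last (h : M.IsSkewTridiagonal d) (x : ℝ) :
    (M + single (Fin.last n) (Fin.last n) (x : ℂ)).IsSkewTridiagonal (d + Pi.single n x) where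
  diag i := by
    rcases eq_or_ne i (Fin.last n) with rfl | hi
    · simp [h.diag]
    · have : (i : ℕ) ≠ n := fun e => hi (Fin.ext e)
      simp [h.diag, hi.symm, this]
  mul i j hij := by
    have hi : Fin.last n ≠ i := fun e => by simp [← e] at hij; omega
    simpa [hi] using h.mul i j hij
  upper i j hij := by
    have hi : Fin.last n ≠ i := fun e => by simp [← e] at hij; omega
    simpa [hi] using h.upper i j hij
  lower i j hij := by
    have hi : Fin.last n ≠ i := fun e => by simp [← e] at hij; omega
    simpa [hi] using h.lower i j hij

end IsSkewTridiagonal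

/-- Schur complement of a block that is coupled to a single index of the other block. -/
theorem det_fromBlocks_of_coupling {m n : Type*} [Fintype m] [Fintype n] [DecidableEq m]
    [DecidableEq n] {A : Matrix m m ℂ} {B : Matrix m n ℂ} {C : Matrix n m ℂ} (D : Matrix n n ℂ)
    (hA : A.det ≠ 0) {v : n} (hB : ∀ k j, j ≠ v → B k j = 0) (hC : ∀ j k, j ≠ v → C j k = 0)
    {x : ℂ} (hx : C v ⬝ᵥ A⁻¹ *ᵥ (fun k => B k v) = -x) :
    (fromBlocks A B C D).det = A.det * (D + single v v x).det := by
  let _ := invertibleOfIsUnitDet A (isUnit_iff_ne_zero.2 hA)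
  rw [det_fromBlocks₁₁, invOf_eq_nonsing_inv, Matrix.mul_assoc]
  congr 2
  ext i j
  rw [sub_apply, add_apply, sub_eq_add_neg]
  congr 1
  rw [neg_eq_iff_eq_neg]
  by_cases hi : i = v
  · by_cases hj : j = v
    · subst hi hj
      rw [single_apply_same, ← hx]
      rfl
    · have : ∀ k, (A⁻¹ * B) k j = 0 := fun k => by simp [mul_apply, hB _ j hj]
      rw [mul_apply]
      simp [this, Ne.symm hj]
  · rw [mul_apply]
    simp [hC i _ hi, Ne.symm hi]

end Matrix

/-! ### Schur complement of a cycle onto its base vertex -/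

section CycleSchurComplement

open Matrix SimpleGraph

theorem Fin.val_sub_cases {n : ℕ} (a b : Fin n) :
    b.val ≤ a.val ∧ (a - b).val = a.val - b.val ∨
      a.val < b.val ∧ (a - b).val = n + a.val - b.val := by
  rcases le_or_gt b a with h | h
  · exact Or.inl ⟨h, Fin.sub_val_of_le h⟩
  · exact Or.inr ⟨h, Fin.coe_sub_iff_lt.2 h⟩

/-- The path obtained from a cycle by deleting vertex `0`. -/
def SimpleGraph.pathEmbeddingCycle (n : ℕ) : pathGraph (n + 1) ↪g cycleGraph (n + 2) where
  toFun := Fin.succ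
  inj' := Fin.succ_injective _
  map_rel_iff' {i j} := by
    have h1 := Fin.val_sub_cases i.succ j.succ
    have h2 := Fin.val_sub_cases j.succ i.succ
    have := i.isLt
    have := j.isLt
    simp only [Function.Embedding.coeFn_mk, cycleGraph_adj', pathGraph_adj]
    rw [Fin.val_succ, Fin.val_succ] at h1 h2
    omega

theorem SimpleGraph.cycleGraph_adj_zero_succ {n : ℕ} {k : Fin (n + 1)} :
    (cycleGraph (n + 2)).Adj 0 k.succ ↔ k = 0 ∨ k = Fin.last n := by
  have h1 := Fin.val_sub_cases 0 k.succ
  have h2 := Fin.val_sub_cases k.succ 0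
  have := k.isLt
  rw [Fin.val_succ, Fin.val_zero] at h1 h2
  rw [cycleGraph_adj', Fin.ext_iff, Fin.ext_iff, Fin.val_zero, Fin.val_last]
  omega

theorem finRotate_castSucc {n : ℕ} (i : Fin (n + 1)) :
    finRotate (n + 2) i.castSucc = i.succ := by
  rw [finRotate_apply, Fin.coeSucc_eq_succ]

namespace UnitGainGraph

variable {V : Type*} [DecidableEq V] {G : SimpleGraph V}

theorem isSkewTridiagonal_shiftMatrix_submatrix (Φ : UnitGainGraph G) (t : ℝ) {n : ℕ}
    (f : pathGraph n ↪g G) : ((Φ.shiftMatrix t).submatrix f f).IsSkewTridiagonal fun _ => t where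
  diag i := Φ.shiftMatrix_self t _
  mul i j hij := Φ.shiftMatrix_mul_symm t (f.map_adj_iff.2 (pathGraph_adj.2 (Or.inl hij.symm)))
  upper i j hij := Φ.shiftMatrix_of_not_adj t (f.injective.ne fun e => by subst e; omega)
    fun h => by have := pathGraph_adj.1 (f.map_adj_iff.1 h); omega
  lower i j hij := Φ.shiftMatrix_of_not_adj t (f.injective.ne fun e => by subst e; omega)
    fun h => by have := pathGraph_adj.1 (f.map_adj_iff.1 h); omega

theorem prod_shiftMatrix_cycle (Φ : UnitGainGraph G) (t : ℝ) {n : ℕ} (hn : 3 ≤ n + 2)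
    (c : cycleGraph (n + 2) →g G) :
    ∏ i, Φ.shiftMatrix t (c i) (c (finRotate (n + 2) i)) =
      Complex.I ^ (n + 2) * (Φ.cycleGain hn c : ℂ) := by
  have h (i : Fin (n + 2)) := Φ.shiftMatrix_of_adj t (c.map_adj (cycleGraph_adj_finRotate hn i))
  simp_rw [h]
  rw [Finset.prod_mul_distrib, Finset.prod_const, Finset.card_univ, Fintype.card_fin]
  exact congrArg _ (map_prod Circle.coeHom _ _).symm

theorem prod_shiftMatrix_cycle' (Φ : UnitGainGraph G) (t : ℝ) {n : ℕ} (hn : 3 ≤ n + 2)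
    (c : cycleGraph (n + 2) →g G) :
    ∏ i, Φ.shiftMatrix t (c (finRotate (n + 2) i)) (c i) =
      Complex.I ^ (n + 2) * starRingEnd ℂ (Φ.cycleGain hn c : ℂ) := by
  have h (i : Fin (n + 2)) := Φ.shiftMatrix_of_adj' t (c.map_adj (cycleGraph_adj_finRotate hn i))
  simp_rw [h]
  rw [Finset.prod_mul_distrib, Finset.prod_const, Finset.card_univ, Fintype.card_fin, ← map_prod]
  exact congrArg (fun z => _ * starRingEnd ℂ z) (map_prod Circle.coeHom _ _).symm

theorem I_pow_even {n : ℕ} (hn : Even n) : Complex.I ^ n = (-1) ^ (n / 2) := by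
  obtain ⟨k, rfl⟩ := hn
  rw [← two_mul, pow_mul, Complex.I_sq]
  simp

/-- The sum of the diagonal entry `t` and this number is the Schur complement of vertex `0` in the
matrix `t + i A` of a cycle of even length `n + 2`, where `x = (-1) ^ ((n + 2) / 2) * Re γ`. -/
noncomputable def cycleWeight (n : ℕ) (t x : ℝ) : ℝ :=
  (2 * continuant n (fun _ => t) - 2 * x) / continuant (n + 1) (fun _ => t)

theorem det_pathBlock (Φ : UnitGainGraph G) (t : ℝ) {n : ℕ} (c : cycleGraph (n + 2) ↪g G) :
    ((Φ.shiftMatrix t).submatrix (fun i : Fin (n + 1) => c i.succ)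
      fun i : Fin (n + 1) => c i.succ).det =
      continuant (n + 1) (fun _ => t) :=
  (Φ.isSkewTridiagonal_shiftMatrix_submatrix t ((pathEmbeddingCycle n).trans c)).det_eq

/-- The base vertex meets the rest of the cycle only at the two ends of a path, so only the four
corner entries of the inverse enter. The diagonal corners contribute continuants; the other two
complete the products of the entries around the cycle in both directions, which yields `γ` plus its
conjugate. -/
theorem cycle_coupling (Φ : UnitGainGraph G) (t : ℝ) {n : ℕ} (hn : 3 ≤ n + 2) (hne : Even n)
    (c : cycleGraph (n + 2) ↪g G) :
    (fun k : Fin (n + 1) => Φ.shiftMatrix t (c 0) (c k.succ)) ⬝ᵥ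
      ((Φ.shiftMatrix t).submatrix (fun i : Fin (n + 1) => c i.succ)
      fun i : Fin (n + 1) => c i.succ)⁻¹ *ᵥ
        (fun k : Fin (n + 1) => Φ.shiftMatrix t (c k.succ) (c 0)) =
      ((-cycleWeight n t ((-1) ^ ((n + 2) / 2) * (Φ.cycleGain hn c.toHom : ℂ).re) : ℝ) : ℂ) := by
  have hP := Φ.isSkewTridiagonal_shiftMatrix_submatrix t ((pathEmbeddingCycle n).trans c)
  have hp := prod_shiftMatrix_cycle Φ t hn c.toHom
  have hp' := prod_shiftMatrix_cycle' Φ t hn c.toHom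
  have hdet := det_pathBlock Φ t c
  have e : ((pathEmbeddingCycle n).trans c : Fin (n + 1) → V) = fun i : Fin (n + 1) => c i.succ := rfl
  rw [e] at hP
  set P := (Φ.shiftMatrix t).submatrix (fun i : Fin (n + 1) => c i.succ)
      fun i : Fin (n + 1) => c i.succ with hPd
  -- The two neighbours of the base vertex are distinct because the cycle has at least three
  -- vertices.
  have h0l : (0 : Fin (n + 1)) ≠ Fin.last n := by
    rw [Ne, Fin.ext_iff, Fin.val_zero, Fin.val_last]
    omega
  have hw (k : Fin (n + 1)) (h0 : k ≠ 0) (hl : k ≠ Fin.last n) :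
      ¬ G.Adj (c 0) (c k.succ) := by
    rw [c.map_adj_iff, cycleGraph_adj_zero_succ]
    tauto
  have hne0 (k : Fin (n + 1)) : c 0 ≠ c k.succ := c.injective.ne (Fin.succ_ne_zero k).symm
  have h1 : (fun k : Fin (n + 1) => Φ.shiftMatrix t (c 0) (c k.succ)) =
      Pi.single 0 (Φ.shiftMatrix t (c 0) (c 1)) +
        Pi.single (Fin.last n) (Φ.shiftMatrix t (c 0) (c (Fin.last (n + 1)))) := by
    funext k
    rcases eq_or_ne k 0 with rfl | h0
    · simp [h0l]
    · rcases eq_or_ne k (Fin.last n) with rfl | hl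
      · simp [h0]
      · simp [h0, hl, Φ.shiftMatrix_of_not_adj t (hne0 k) (hw k h0 hl)]
  have h2 : (fun k : Fin (n + 1) => Φ.shiftMatrix t (c k.succ) (c 0)) =
      Pi.single 0 (Φ.shiftMatrix t (c 1) (c 0)) +
        Pi.single (Fin.last n) (Φ.shiftMatrix t (c (Fin.last (n + 1))) (c 0)) := by
    funext k
    rcases eq_or_ne k 0 with rfl | h0
    · simp [h0l]
    · rcases eq_or_ne k (Fin.last n) with rfl | hl
      · simp [h0]
      · simp [h0, hl, Φ.shiftMatrix_of_not_adj t (hne0 k).symm fun h => hw k h0 hl h.symm]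
  have ha1 : Φ.shiftMatrix t (c 0) (c 1) * Φ.shiftMatrix t (c 1) (c 0) = -1 :=
    Φ.shiftMatrix_mul_symm t (c.map_adj_iff.2 (cycleGraph_adj_zero_succ.2 (Or.inl rfl)))
  have ha2 : Φ.shiftMatrix t (c 0) (c (Fin.last (n + 1))) *
      Φ.shiftMatrix t (c (Fin.last (n + 1))) (c 0) = -1 :=
    Φ.shiftMatrix_mul_symm t
      (c.map_adj_iff.2 (by rw [← Fin.succ_last]; exact cycleGraph_adj_zero_succ.2 (Or.inr rfl)))
  rw [Fin.prod_univ_castSucc, Fin.prod_univ_succ] at hp hp'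
  simp only [finRotate_castSucc, finRotate_last] at hp hp'
  have h00 := hP.adjugate_zero_zero
  have hll := hP.adjugate_last_last
  have h0l' := hP.adjugate_zero_last
  have hl0' := hP.adjugate_last_zero
  -- Even length removes the cofactor sign and, next, makes `i ^ (n + 2)` a real sign.
  rw [hne.neg_one_pow, one_mul] at h0l' hl0'
  rw [I_pow_even (by simpa [Nat.even_add] using hne)] at hp hp'
  have hPa (i j : Fin (n + 1)) : P i j = Φ.shiftMatrix t (c i.succ) (c j.succ) := rfl
  simp only [hPa] at h0l' hl0'
  simp only [Fin.castSucc_zero, Fin.succ_zero_eq_one, RelEmbedding.coe_toRelHom,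
    ← Fin.succ_castSucc, ← h0l', ← hl0'] at hp hp'
  rw [h1, h2, inv_def, hdet, smul_mulVec, dotProduct_smul, mulVec_add, dotProduct_add,
    add_dotProduct, add_dotProduct]
  simp only [mulVec_single, single_dotProduct, Pi.smul_apply, MulOpposite.smul_eq_mul_unop,
    MulOpposite.unop_op, col_apply, h00, hll, Ring.inverse_eq_inv', smul_eq_mul]
  have hre : (Φ.cycleGain hn c.toHom : ℂ) + starRingEnd ℂ (Φ.cycleGain hn c.toHom : ℂ) =
    (2 * (Φ.cycleGain hn c.toHom : ℂ).re : ℝ) := Complex.add_conj _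
  rw [cycleWeight]
  push_cast at hre ⊢
  linear_combination (continuant (n + 1) fun _ => t : ℂ)⁻¹ *
    ((continuant n fun _ => t : ℂ) * ha1 + (continuant n fun _ => t : ℂ) * ha2 + hp + hp' +
      (-1) ^ ((n + 2) / 2) * hre)

end UnitGainGraph

end CycleSchurComplement

/-! ### The determinant of a dumbbell gain graph -/

section DumbbellDeterminant

open Matrix SimpleGraph

section Dumbbell

variable {r s ℓ : ℕ}

theorem dumbbellGraph_adj_left_left {i j : Fin r} :
    (dumbbellGraph r s ℓ).Adj (.inl (.inl i)) (.inl (.inl j)) ↔ (cycleGraph r).Adj i j := by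
  simp [dumbbellGraph, dumbbellLink]

theorem dumbbellGraph_adj_right_right {i j : Fin s} :
    (dumbbellGraph r s ℓ).Adj (.inl (.inr i)) (.inl (.inr j)) ↔ (cycleGraph s).Adj i j := by
  simp [dumbbellGraph, dumbbellLink]

theorem dumbbellGraph_adj_path_path {p q : Fin (ℓ - 1)} :
    (dumbbellGraph r s ℓ).Adj (.inr p) (.inr q) ↔ (pathGraph (ℓ - 1)).Adj p q := by
  simp [dumbbellGraph, dumbbellLink]

theorem dumbbellGraph_adj_left_right {i : Fin r} {j : Fin s} :
    (dumbbellGraph r s ℓ).Adj (.inl (.inl i)) (.inl (.inr j)) ↔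
      ℓ = 1 ∧ i.val = 0 ∧ j.val = 0 := by
  simp [dumbbellGraph, dumbbellLink]

theorem dumbbellGraph_adj_left_path {i : Fin r} {p : Fin (ℓ - 1)} :
    (dumbbellGraph r s ℓ).Adj (.inl (.inl i)) (.inr p) ↔ i.val = 0 ∧ p.val = 0 := by
  simp [dumbbellGraph, dumbbellLink]

theorem dumbbellGraph_adj_right_path {j : Fin s} {p : Fin (ℓ - 1)} :
    (dumbbellGraph r s ℓ).Adj (.inl (.inr j)) (.inr p) ↔ p.val + 2 = ℓ ∧ j.val = 0 := by
  simp [dumbbellGraph, dumbbellLink]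

theorem dumbbellGraph_adj_right_left {i : Fin r} {j : Fin s} :
    (dumbbellGraph r s ℓ).Adj (.inl (.inr j)) (.inl (.inl i)) ↔
      ℓ = 1 ∧ i.val = 0 ∧ j.val = 0 := by
  rw [adj_comm, dumbbellGraph_adj_left_right]

theorem dumbbellGraph_adj_path_left {i : Fin r} {p : Fin (ℓ - 1)} :
    (dumbbellGraph r s ℓ).Adj (.inr p) (.inl (.inl i)) ↔ i.val = 0 ∧ p.val = 0 := by
  rw [adj_comm, dumbbellGraph_adj_left_path]

theorem dumbbellGraph_adj_path_right {j : Fin s} {p : Fin (ℓ - 1)} :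
    (dumbbellGraph r s ℓ).Adj (.inr p) (.inl (.inr j)) ↔ p.val + 2 = ℓ ∧ j.val = 0 := by
  rw [adj_comm, dumbbellGraph_adj_right_path]

/-- The cycle `C_r` as an induced subgraph of the dumbbell graph. -/
def dumbbellEmbeddingLeft (r s ℓ : ℕ) : cycleGraph r ↪g dumbbellGraph r s ℓ where
  toFun i := .inl (.inl i)
  inj' _ _ h := Sum.inl_injective (Sum.inl_injective h)
  map_rel_iff' := dumbbellGraph_adj_left_left

/-- The cycle `C_s` as an induced subgraph of the dumbbell graph. -/
def dumbbellEmbeddingRight (r s ℓ : ℕ) : cycleGraph s ↪g dumbbellGraph r s ℓ where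
  toFun i := .inl (.inr i)
  inj' _ _ h := Sum.inr_injective (Sum.inl_injective h)
  map_rel_iff' := dumbbellGraph_adj_right_right

end Dumbbell

section Path

variable (m n c : ℕ)

/-- The vertices of the joining path of the dumbbell graph, both ends included. -/
def dumbbellPathFun (k : Fin (c + 2)) : (Fin (m + 2) ⊕ Fin (n + 2)) ⊕ Fin (c + 1 - 1) :=
  if h0 : k.val = 0 then .inl (.inl 0)
  else if h : k.val ≤ c then .inr ⟨k.val - 1, by omega⟩
  else .inl (.inr 0)

theorem dumbbellPathFun_cases (k : Fin (c + 2)) :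
    (k.val = 0 ∧ dumbbellPathFun m n c k = .inl (.inl 0)) ∨
      (∃ p : Fin (c + 1 - 1), k.val = p.val + 1 ∧ dumbbellPathFun m n c k = .inr p) ∨
      (k.val = c + 1 ∧ dumbbellPathFun m n c k = .inl (.inr 0)) := by
  have := k.isLt
  by_cases h0 : k.val = 0
  · exact Or.inl ⟨h0, dif_pos h0⟩
  · by_cases hc : k.val ≤ c
    · exact Or.inr (Or.inl ⟨⟨k.val - 1, by omega⟩, by simp only; omega,
        (dif_neg h0).trans (dif_pos hc)⟩)
    · exact Or.inr (Or.inr ⟨by omega, (dif_neg h0).trans (dif_neg hc)⟩)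

theorem dumbbellPathFun_injective : Function.Injective (dumbbellPathFun m n c) := by
  intro i j h
  ext
  rcases dumbbellPathFun_cases m n c i with ⟨hi, hi'⟩ | ⟨p, hi, hi'⟩ | ⟨hi, hi'⟩ <;>
  rcases dumbbellPathFun_cases m n c j with ⟨hj, hj'⟩ | ⟨q, hj, hj'⟩ | ⟨hj, hj'⟩ <;>
  rw [hi', hj'] at h <;>
  simp only [Sum.inl.injEq, Sum.inr.injEq, reduceCtorEq] at h <;>
  omega

/-- The joining path of the dumbbell graph as an induced subgraph. -/
def dumbbellPath : pathGraph (c + 2) ↪g dumbbellGraph (m + 2) (n + 2) (c + 1) where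
  toFun := dumbbellPathFun m n c
  inj' := dumbbellPathFun_injective m n c
  map_rel_iff' {i j} := by
    rw [pathGraph_adj]
    change (dumbbellGraph (m + 2) (n + 2) (c + 1)).Adj (dumbbellPathFun m n c i)
      (dumbbellPathFun m n c j) ↔ _
    rcases dumbbellPathFun_cases m n c i with ⟨hi, hi'⟩ | ⟨p, hi, hi'⟩ | ⟨hi, hi'⟩ <;>
    rcases dumbbellPathFun_cases m n c j with ⟨hj, hj'⟩ | ⟨q, hj, hj'⟩ | ⟨hj, hj'⟩ <;>
    simp only [hi', hj', SimpleGraph.irrefl, dumbbellGraph_adj_path_path,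
      dumbbellGraph_adj_left_right, dumbbellGraph_adj_left_path, dumbbellGraph_adj_right_path,
      dumbbellGraph_adj_right_left, dumbbellGraph_adj_path_left, dumbbellGraph_adj_path_right,
      pathGraph_adj, Fin.val_zero, true_and, and_true, false_iff] <;>
    omega

theorem dumbbellPath_last : dumbbellPath m n c (Fin.last (c + 1)) = .inl (.inr 0) := by
  change dumbbellPathFun m n c (Fin.last (c + 1)) = _
  simp [dumbbellPathFun]

/-- Enumeration of the vertices of the dumbbell graph: the two cycles without their base vertices,
then the joining path with both ends. -/
def dumbbellVertexFun : Fin (m + 1) ⊕ (Fin (n + 1) ⊕ Fin (c + 2)) →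
    (Fin (m + 2) ⊕ Fin (n + 2)) ⊕ Fin (c + 1 - 1)
  | .inl i => .inl (.inl i.succ)
  | .inr (.inl j) => .inl (.inr j.succ)
  | .inr (.inr k) => dumbbellPath m n c k

theorem dumbbellPath_ne_left (k : Fin (c + 2)) (i : Fin (m + 1)) :
    dumbbellPath m n c k ≠ .inl (.inl i.succ) := by
  change dumbbellPathFun m n c k ≠ _
  rcases dumbbellPathFun_cases m n c k with ⟨_, hk⟩ | ⟨p, _, hk⟩ | ⟨_, hk⟩ <;> rw [hk] <;>
    simp only [ne_eq, Sum.inl.injEq, reduceCtorEq, not_false_eq_true]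
  exact (Fin.succ_ne_zero i).symm

theorem dumbbellPath_ne_right (k : Fin (c + 2)) (j : Fin (n + 1)) :
    dumbbellPath m n c k ≠ .inl (.inr j.succ) := by
  change dumbbellPathFun m n c k ≠ _
  rcases dumbbellPathFun_cases m n c k with ⟨_, hk⟩ | ⟨p, _, hk⟩ | ⟨_, hk⟩ <;> rw [hk] <;>
    simp only [ne_eq, Sum.inl.injEq, Sum.inr.injEq, reduceCtorEq, not_false_eq_true]
  exact (Fin.succ_ne_zero j).symm

theorem dumbbellVertexFun_bijective : Function.Bijective (dumbbellVertexFun m n c) := by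
  rw [Fintype.bijective_iff_injective_and_card]
  constructor
  · rintro (i | i | i) (j | j | j) h
    · exact congrArg _ (Fin.succ_injective _ (Sum.inl_injective (Sum.inl_injective h)))
    · exact absurd (Sum.inl_injective h) Sum.inl_ne_inr
    · exact absurd h.symm (dumbbellPath_ne_left m n c j i)
    · exact absurd (Sum.inl_injective h) Sum.inr_ne_inl
    · exact congrArg _ (congrArg _
        (Fin.succ_injective _ (Sum.inr_injective (Sum.inl_injective h))))
    · exact absurd h.symm (dumbbellPath_ne_right m n c j i)
    · exact absurd h (dumbbellPath_ne_left m n c i j)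
    · exact absurd h (dumbbellPath_ne_right m n c i j)
    · exact congrArg _ (congrArg _ ((dumbbellPath m n c).injective h))
  · simp only [Fintype.card_sum, Fintype.card_fin]
    omega

theorem not_adj_left_dumbbellPath {k : Fin (c + 2)} (hk : k ≠ 0) (i : Fin (m + 1)) :
    ¬ (dumbbellGraph (m + 2) (n + 2) (c + 1)).Adj (.inl (.inl i.succ)) (dumbbellPath m n c k) := by
  have hk0 : k.val ≠ 0 := fun e => hk (Fin.ext e)
  change ¬ (dumbbellGraph (m + 2) (n + 2) (c + 1)).Adj _ (dumbbellPathFun m n c k)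
  rcases dumbbellPathFun_cases m n c k with ⟨hk', _⟩ | ⟨p, _, hk'⟩ | ⟨_, hk'⟩
  · exact absurd hk' hk0
  · rw [hk', dumbbellGraph_adj_left_path, Fin.val_succ]
    omega
  · rw [hk', dumbbellGraph_adj_left_right, Fin.val_succ]
    omega

theorem not_adj_right_dumbbellPath {k : Fin (c + 2)} (hk : k ≠ Fin.last (c + 1))
    (j : Fin (n + 1)) :
    ¬ (dumbbellGraph (m + 2) (n + 2) (c + 1)).Adj (.inl (.inr j.succ)) (dumbbellPath m n c k) := by
  have hk0 : k.val ≠ c + 1 := fun e => hk (Fin.ext e)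
  change ¬ (dumbbellGraph (m + 2) (n + 2) (c + 1)).Adj _ (dumbbellPathFun m n c k)
  rcases dumbbellPathFun_cases m n c k with ⟨_, hk'⟩ | ⟨p, _, hk'⟩ | ⟨hk', _⟩
  · rw [hk', dumbbellGraph_adj_right_left, Fin.val_succ]
    omega
  · rw [hk', dumbbellGraph_adj_right_path, Fin.val_succ]
    omega
  · exact absurd hk' hk0

theorem not_adj_left_right_succ (i : Fin (m + 1)) (j : Fin (n + 1)) :
    ¬ (dumbbellGraph (m + 2) (n + 2) (c + 1)).Adj (.inl (.inl i.succ)) (.inl (.inr j.succ)) := by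
  rw [dumbbellGraph_adj_left_right, Fin.val_succ]
  omega

end Path

section Determinant

variable {m n c : ℕ}

/-- Two successive Schur complements, one for each cycle without its base vertex; each is coupled to
a single end of the joining path and only changes that diagonal entry. -/
theorem det_shiftMatrix_dumbbell (hm : 3 ≤ m + 2) (hn : 3 ≤ n + 2) (hme : Even m) (hne : Even n)
    (Φ : UnitGainGraph (dumbbellGraph (m + 2) (n + 2) (c + 1))) {t : ℝ} (ht : 0 < t) :
    (Φ.shiftMatrix t).det =
      ((continuant (m + 1) (fun _ => t) * (continuant (n + 1) (fun _ => t) *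
        continuant (c + 2) ((fun _ => t) +
          (Pi.single 0 (UnitGainGraph.cycleWeight m t (alphaParam hm Φ)) +
            Pi.single (c + 1) (UnitGainGraph.cycleWeight n t (betaParam hn Φ))))) : ℝ) : ℂ) := by
  let M := Φ.shiftMatrix t
  let e := Equiv.ofBijective _ (dumbbellVertexFun_bijective m n c)
  have hp (k : ℕ) : ((continuant k (fun _ => t) : ℝ) : ℂ) ≠ 0 :=
    Complex.ofReal_ne_zero.2 (continuant_pos k fun _ => ht).ne'
  let N := M.submatrix e e
  have hN : N.det = M.det := det_submatrix_equiv_self e M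
  have hQ := Φ.isSkewTridiagonal_shiftMatrix_submatrix t (dumbbellPath m n c)
  have hPl := Φ.det_pathBlock t (dumbbellEmbeddingLeft (m + 2) (n + 2) (c + 1))
  have hPr := Φ.det_pathBlock t (dumbbellEmbeddingRight (m + 2) (n + 2) (c + 1))
  have hσl := Φ.cycle_coupling t hm hme (dumbbellEmbeddingLeft (m + 2) (n + 2) (c + 1))
  have hσr := Φ.cycle_coupling t hn hne (dumbbellEmbeddingRight (m + 2) (n + 2) (c + 1))
  have hl0 (i : Fin (m + 1)) (j : Fin (n + 1) ⊕ Fin (c + 2)) (hj : j ≠ .inr 0) :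
      ¬ (dumbbellGraph (m + 2) (n + 2) (c + 1)).Adj (e (.inl i)) (e (.inr j)) := by
    rcases j with j | j
    · exact not_adj_left_right_succ m n c i j
    · exact not_adj_left_dumbbellPath m n c (fun h => hj (congrArg _ h)) i
  have hr0 (i : Fin (n + 1)) (j : Fin (c + 2)) (hj : j ≠ Fin.last (c + 1)) :
      ¬ (dumbbellGraph (m + 2) (n + 2) (c + 1)).Adj (e (.inr (.inl i))) (e (.inr (.inr j))) :=
    not_adj_right_dumbbellPath m n c hj i
  have h1 : N.det = continuant (m + 1) (fun _ => t) *
      (N.toBlocks₂₂ + single (Sum.inr 0) (Sum.inr 0)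
        (UnitGainGraph.cycleWeight m t (alphaParam hm Φ) : ℂ)).det := by
    have key := det_fromBlocks_of_coupling N.toBlocks₂₂ (A := N.toBlocks₁₁) (B := N.toBlocks₁₂)
      (C := N.toBlocks₂₁) (hPl.trans_ne (hp _)) (v := .inr 0)
      (fun k j hj => Φ.shiftMatrix_of_not_adj t (e.injective.ne Sum.inl_ne_inr) (hl0 k j hj))
      (fun j k hj => Φ.shiftMatrix_of_not_adj t (e.injective.ne Sum.inr_ne_inl)
        fun h => hl0 k j hj h.symm) (hσl.trans (Complex.ofReal_neg _))
    rw [fromBlocks_toBlocks] at key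
    exact key.trans (congrArg (· * _) hPl)
  set D := N.toBlocks₂₂ + single (Sum.inr 0) (Sum.inr 0)
        (UnitGainGraph.cycleWeight m t (alphaParam hm Φ) : ℂ) with hD
  -- The first correction lies in the path block, so the coupling of the second cycle to the path is
  -- unchanged.
  have h11 : D.toBlocks₁₁ = N.toBlocks₂₂.toBlocks₁₁ := by
    ext i j
    simp [hD, toBlocks₁₁]
  have h12 : D.toBlocks₁₂ = N.toBlocks₂₂.toBlocks₁₂ := by
    ext i j
    simp [hD, toBlocks₁₂]
  have h21 : D.toBlocks₂₁ = N.toBlocks₂₂.toBlocks₂₁ := by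
    ext i j
    simp [hD, toBlocks₂₁]
  have h22 : D.toBlocks₂₂ = N.toBlocks₂₂.toBlocks₂₂ + single 0 0
        (UnitGainGraph.cycleWeight m t (alphaParam hm Φ) : ℂ) := by
    ext i j
    simp [hD, toBlocks₂₂, single_apply]
  have h2 : D.det = continuant (n + 1) (fun _ => t) *
      (D.toBlocks₂₂ + single (Fin.last (c + 1)) (Fin.last (c + 1))
        (UnitGainGraph.cycleWeight n t (betaParam hn Φ) : ℂ)).det := by
    -- The far end of the path is the base vertex of the second cycle, which makes the coupling
    -- computed for that cycle applicable.
    have he : e (.inr (.inr (Fin.last (c + 1)))) = .inl (.inr 0) := dumbbellPath_last m n c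
    have hσ : N.toBlocks₂₂.toBlocks₂₁ (Fin.last (c + 1)) ⬝ᵥ N.toBlocks₂₂.toBlocks₁₁⁻¹ *ᵥ
        (fun k => N.toBlocks₂₂.toBlocks₁₂ k (Fin.last (c + 1))) =
        -(UnitGainGraph.cycleWeight n t (betaParam hn Φ) : ℂ) := by
      refine Eq.trans (congrArg₂ _ (funext fun k => ?_) (congrArg _ (funext fun k => ?_)))
        (hσr.trans (Complex.ofReal_neg _))
      · change Φ.shiftMatrix t (e (.inr (.inr (Fin.last (c + 1))))) _ = _
        rw [he]
        rfl
      · change Φ.shiftMatrix t _ (e (.inr (.inr (Fin.last (c + 1))))) = _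
        rw [he]
        rfl
    have key := det_fromBlocks_of_coupling D.toBlocks₂₂ (A := N.toBlocks₂₂.toBlocks₁₁)
      (B := N.toBlocks₂₂.toBlocks₁₂) (C := N.toBlocks₂₂.toBlocks₂₁) (hPr.trans_ne (hp _))
      (v := Fin.last (c + 1))
      (fun k j hj => Φ.shiftMatrix_of_not_adj t
        (e.injective.ne (Sum.inr_injective.ne Sum.inl_ne_inr)) (hr0 k j hj))
      (fun j k hj => Φ.shiftMatrix_of_not_adj t
        (e.injective.ne (Sum.inr_injective.ne Sum.inr_ne_inl)) fun h => hr0 k j hj h.symm) hσ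
    rw [← h11, ← h12, ← h21, fromBlocks_toBlocks] at key
    rw [key, h11]
    exact congrArg (· * _) hPr
  have h3 := ((hQ.add_single_zero (UnitGainGraph.cycleWeight m t (alphaParam hm Φ))).add_single_last
    (UnitGainGraph.cycleWeight n t (betaParam hn Φ))).det_eq
  change M.det = _
  rw [← hN, h1, h2, h22, Complex.ofReal_mul, Complex.ofReal_mul, ← add_assoc, ← h3]
  rfl

end Determinant

end DumbbellDeterminant

/-! ### Monotonicity in the parameters -/

section DumbbellExtremal

open SimpleGraph

section Monotonicity

variable {m n c : ℕ}

theorem UnitGainGraph.cycleWeight_nonneg (hm : Even m) {t x : ℝ} (ht : 0 < t) (hx : x ≤ 1) :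
    0 ≤ UnitGainGraph.cycleWeight m t x := by
  have h := one_le_continuant m (fun _ => ht) hm
  exact div_nonneg (by linarith) (continuant_pos _ fun _ => ht).le

theorem UnitGainGraph.cycleWeight_strictAnti (m : ℕ) {t : ℝ} (ht : 0 < t) :
    StrictAnti (UnitGainGraph.cycleWeight m t) := fun x y h =>
  div_lt_div_of_pos_right (by linarith) (continuant_pos _ fun _ => ht)

theorem abs_neg_one_pow_mul_re_le_one (k : ℕ) (z : Circle) :
    |(-1 : ℝ) ^ k * (z : ℂ).re| ≤ 1 := by
  rw [abs_mul, abs_neg_one_pow, one_mul]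
  exact (Complex.abs_re_le_norm _).trans_eq (Circle.norm_coe z)

theorem abs_alphaParam_le_one {r s ℓ : ℕ} (hr : 3 ≤ r) (Φ : UnitGainGraph (dumbbellGraph r s ℓ)) :
    |alphaParam hr Φ| ≤ 1 := abs_neg_one_pow_mul_re_le_one _ _

theorem abs_betaParam_le_one {r s ℓ : ℕ} (hs : 3 ≤ s) (Φ : UnitGainGraph (dumbbellGraph r s ℓ)) :
    |betaParam hs Φ| ≤ 1 := abs_neg_one_pow_mul_re_le_one _ _

/-- The diagonal of the Schur complement onto the joining path of a dumbbell graph. -/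
noncomputable def dumbbellDiag (m n c : ℕ) (t x y : ℝ) : ℕ → ℝ :=
  (fun _ => t) + (Pi.single 0 (UnitGainGraph.cycleWeight m t x) +
    Pi.single (c + 1) (UnitGainGraph.cycleWeight n t y))

theorem dumbbellDiag_pos (hm : Even m) (hn : Even n) {t x y : ℝ} (ht : 0 < t) (hx : x ≤ 1)
    (hy : y ≤ 1) (i : ℕ) : 0 < dumbbellDiag m n c t x y i := by
  have h1 : 0 ≤ Pi.single (M := fun _ : ℕ => ℝ) 0 (UnitGainGraph.cycleWeight m t x) :=
    Pi.single_nonneg.2 (UnitGainGraph.cycleWeight_nonneg hm ht hx)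
  have h2 : 0 ≤ Pi.single (M := fun _ : ℕ => ℝ) (c + 1) (UnitGainGraph.cycleWeight n t y) :=
    Pi.single_nonneg.2 (UnitGainGraph.cycleWeight_nonneg hn ht hy)
  exact add_pos_of_pos_of_nonneg ht (add_nonneg (h1 i) (h2 i))

theorem dumbbellDiag_anti {t x y x' y' : ℝ} (ht : 0 < t) (hx : x' ≤ x) (hy : y' ≤ y) (i : ℕ) :
    dumbbellDiag m n c t x y i ≤ dumbbellDiag m n c t x' y' i :=
  add_le_add le_rfl (add_le_add
    (Pi.single_mono (f := fun _ : ℕ => ℝ) 0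
      ((UnitGainGraph.cycleWeight_strictAnti m ht).antitone hx) i)
    (Pi.single_mono (f := fun _ : ℕ => ℝ) (c + 1)
      ((UnitGainGraph.cycleWeight_strictAnti n ht).antitone hy) i))

theorem norm_det_shiftMatrix_dumbbell (hm : 3 ≤ m + 2) (hn : 3 ≤ n + 2) (hme : Even m)
    (hne : Even n) (Φ : UnitGainGraph (dumbbellGraph (m + 2) (n + 2) (c + 1))) {t : ℝ}
    (ht : 0 < t) :
    ‖(Φ.shiftMatrix t).det‖ =
      continuant (m + 1) (fun _ => t) * (continuant (n + 1) (fun _ => t) *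
        continuant (c + 2) (dumbbellDiag m n c t (alphaParam hm Φ) (betaParam hn Φ))) := by
  rw [det_shiftMatrix_dumbbell hm hn hme hne Φ ht, Complex.norm_real]
  refine Real.norm_of_nonneg (mul_nonneg (continuant_pos _ fun _ => ht).le
    (mul_nonneg (continuant_pos _ fun _ => ht).le (continuant_pos _
      (dumbbellDiag_pos hme hne ht (le_of_abs_le (abs_alphaParam_le_one hm Φ))
        (le_of_abs_le (abs_betaParam_le_one hn Φ)))).le))

variable (hm : 3 ≤ m + 2) (hn : 3 ≤ n + 2) (hme : Even m) (hne : Even n)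
  {Φ Ψ : UnitGainGraph (dumbbellGraph (m + 2) (n + 2) (c + 1))}

include hme hne

theorem energy_le_of_params_le (hα : alphaParam hm Ψ ≤ alphaParam hm Φ)
    (hβ : betaParam hn Ψ ≤ betaParam hn Φ) : Φ.energy ≤ Ψ.energy :=
  UnitGainGraph.energy_le_of_norm_det_le fun t ht => by
    rw [norm_det_shiftMatrix_dumbbell hm hn hme hne Φ ht,
      norm_det_shiftMatrix_dumbbell hm hn hme hne Ψ ht]
    refine mul_le_mul_of_nonneg_left (mul_le_mul_of_nonneg_left (continuant_mono _
      (dumbbellDiag_pos hme hne ht (le_of_abs_le (abs_alphaParam_le_one hm Φ))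
        (le_of_abs_le (abs_betaParam_le_one hn Φ))) (dumbbellDiag_anti ht hα hβ)) ?_) ?_
    all_goals exact (continuant_pos _ fun _ => ht).le

/-- Of the three continuants in the determinant, only that of the path depends on the gains. A
smaller parameter means a larger weight at one of its ends, hence a larger determinant for every `t
> 0`. -/
theorem energy_lt_of_params_lt (hα : alphaParam hm Ψ ≤ alphaParam hm Φ)
    (hβ : betaParam hn Ψ ≤ betaParam hn Φ)
    (hne' : alphaParam hm Ψ < alphaParam hm Φ ∨ betaParam hn Ψ < betaParam hn Φ) :
    Φ.energy < Ψ.energy :=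
  UnitGainGraph.energy_lt_of_norm_det_lt fun t ht => by
    rw [norm_det_shiftMatrix_dumbbell hm hn hme hne Φ ht,
      norm_det_shiftMatrix_dumbbell hm hn hme hne Ψ ht]
    have hpos := dumbbellDiag_pos (c := c) hme hne ht
      (le_of_abs_le (abs_alphaParam_le_one hm Φ)) (le_of_abs_le (abs_betaParam_le_one hn Φ))
    have hle := dumbbellDiag_anti (m := m) (n := n) (c := c) ht hα hβ
    refine mul_lt_mul_of_pos_left (mul_lt_mul_of_pos_left ?_ ?_) ?_
    · rcases hne' with h | h
      · refine continuant_lt _ hpos hle 0 (by omega) ?_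
        have := UnitGainGraph.cycleWeight_strictAnti m ht h
        simpa [dumbbellDiag] using this
      · refine continuant_lt _ hpos hle (c + 1) (by omega) ?_
        have := UnitGainGraph.cycleWeight_strictAnti n ht h
        simpa [dumbbellDiag] using this
    all_goals exact continuant_pos _ fun _ => ht

end Monotonicity

/-! ### Gain graphs realizing the corner parameters -/

section Existence

/-- The gain graph in which the gain of an edge does not depend on its orientation. -/
def UnitGainGraph.ofEdge {V : Type*} (G : SimpleGraph V) (h : Sym2 V → Circle)
    (hh : ∀ e, (h e)⁻¹ = h e) : UnitGainGraph G where
  gain d := h d.edge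
  gain_symm d := by rw [Dart.edge_symm, hh]

theorem sym2_finRotate_eq_iff {V : Type*} {m : ℕ} (hm : 3 ≤ m + 2) {f : Fin (m + 2) → V}
    (hf : Function.Injective f) (i : Fin (m + 2)) :
    s(f i, f (finRotate (m + 2) i)) = s(f 0, f 1) ↔ i = 0 := by
  rw [Sym2.eq_iff, hf.eq_iff, hf.eq_iff, hf.eq_iff, hf.eq_iff, finRotate_apply]
  constructor
  · rintro (h | ⟨rfl, h⟩)
    · exact h.1
    -- The reversed edge would require `1 + 1 = 0` modulo the length, impossible from length three
    -- on.
    · obtain ⟨k, rfl⟩ : ∃ k, m = k + 1 := ⟨m - 1, by omega⟩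
      simp only [Fin.ext_iff, Fin.val_add, Fin.val_one, Fin.val_zero] at h
      rw [Nat.mod_eq_of_lt (by omega)] at h
      omega
  · rintro rfl
    simp

theorem exists_circle_sign (k : ℕ) {a : ℝ} (ha : a = 1 ∨ a = -1) :
    ∃ z : Circle, z⁻¹ = z ∧ (-1) ^ k * (z : ℂ).re = a := by
  have h1 : ∃ z : Circle, z⁻¹ = z ∧ (z : ℂ).re = 1 := ⟨1, by simp, by simp⟩
  have h2 : ∃ z : Circle, z⁻¹ = z ∧ (z : ℂ).re = -1 :=
    ⟨Circle.exp Real.pi, by ext; simp, by simp⟩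
  rcases neg_one_pow_eq_or ℝ k with hk | hk <;> rcases ha with rfl | rfl <;> simp only [hk]
  · simpa using h1
  · simpa using h2
  · simpa [neg_eq_iff_eq_neg] using h2
  · simpa using h1

/-- One edge of each cycle carries a self-inverse gain and all other edges carry `1`, so the cycle
gain is the gain of that edge. -/
theorem exists_alphaParam_betaParam {m n : ℕ} (ℓ : ℕ) (hm : 3 ≤ m + 2) (hn : 3 ≤ n + 2) {a b : ℝ}
    (ha : a = 1 ∨ a = -1) (hb : b = 1 ∨ b = -1) :
    ∃ Φ : UnitGainGraph (dumbbellGraph (m + 2) (n + 2) ℓ),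
      alphaParam hm Φ = a ∧ betaParam hn Φ = b := by
  classical
  obtain ⟨z, hz, hza⟩ := exists_circle_sign ((m + 2) / 2) ha
  obtain ⟨w, hw, hwb⟩ := exists_circle_sign ((n + 2) / 2) hb
  let h : Sym2 ((Fin (m + 2) ⊕ Fin (n + 2)) ⊕ Fin (ℓ - 1)) → Circle := fun e =>
    if e = s(.inl (.inl 0), .inl (.inl 1)) then z
    else if e = s(.inl (.inr 0), .inl (.inr 1)) then w else 1
  have hh (e) : (h e)⁻¹ = h e := by
    simp only [h]
    split_ifs
    exacts [hz, hw, inv_one]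
  refine ⟨UnitGainGraph.ofEdge _ h hh, ?_, ?_⟩
  · refine Eq.trans (congrArg (fun u : Circle => (-1) ^ ((m + 2) / 2) * (u : ℂ).re) ?_) hza
    have key (i : Fin (m + 2)) : h s(.inl (.inl i), .inl (.inl (finRotate (m + 2) i))) =
        if i = 0 then z else 1 := by
      have h1 := sym2_finRotate_eq_iff hm
        (dumbbellEmbeddingLeft (m + 2) (n + 2) ℓ).injective i
      refine if_congr h1 rfl (if_neg fun e => ?_)
      simp at e
    refine (Finset.prod_congr rfl fun i _ => key i).trans ?_
    simp
  · refine Eq.trans (congrArg (fun u : Circle => (-1) ^ ((n + 2) / 2) * (u : ℂ).re) ?_) hwb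
    have key (i : Fin (n + 2)) : h s(.inl (.inr i), .inl (.inr (finRotate (n + 2) i))) =
        if i = 0 then w else 1 := by
      have h1 := sym2_finRotate_eq_iff hn
        (dumbbellEmbeddingRight (m + 2) (n + 2) ℓ).injective i
      refine (if_neg fun e => ?_).trans (if_congr h1 rfl rfl)
      simp at e
    refine (Finset.prod_congr rfl fun i _ => key i).trans ?_
    simp

end Existence

/-! ### Characterization of the extremal gain graphs -/

section Extremal

theorem Circle.coe_re_eq_one_iff (z : Circle) : (z : ℂ).re = 1 ↔ (z : ℂ) = 1 := by
  refine ⟨fun h => ?_, fun h => by rw [h, Complex.one_re]⟩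
  have h1 := Circle.normSq_coe z
  rw [Complex.normSq_apply, h] at h1
  exact Complex.ext h (by simpa using h1)

theorem Circle.coe_re_eq_neg_one_iff (z : Circle) : (z : ℂ).re = -1 ↔ (z : ℂ) = -1 := by
  refine ⟨fun h => ?_, fun h => by rw [h, Complex.neg_re, Complex.one_re]⟩
  have h1 := Circle.normSq_coe z
  rw [Complex.normSq_apply, h] at h1
  exact Complex.ext h (by simpa using h1)

theorem neg_one_pow_half_of_mod_four_eq_zero {r : ℕ} (h : r % 4 = 0) :
    (-1 : ℝ) ^ (r / 2) = 1 :=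
  Even.neg_one_pow (Nat.even_iff.2 (by omega))

theorem neg_one_pow_half_of_mod_four_eq_two {r : ℕ} (h : r % 4 = 2) :
    (-1 : ℝ) ^ (r / 2) = -1 :=
  Odd.neg_one_pow (Nat.odd_iff.2 (by omega))

variable {r s ℓ : ℕ}

theorem alphaParam_iff_of_mod_four_eq_zero (hr : 3 ≤ r) (h : r % 4 = 0)
    (Φ : UnitGainGraph (dumbbellGraph r s ℓ)) :
    (alphaParam hr Φ = 1 ↔ gammaLeft hr Φ = 1) ∧ (alphaParam hr Φ = -1 ↔ gammaLeft hr Φ = -1) := by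
  rw [alphaParam, neg_one_pow_half_of_mod_four_eq_zero h, one_mul]
  exact ⟨Circle.coe_re_eq_one_iff _, Circle.coe_re_eq_neg_one_iff _⟩

theorem alphaParam_iff_of_mod_four_eq_two (hr : 3 ≤ r) (h : r % 4 = 2)
    (Φ : UnitGainGraph (dumbbellGraph r s ℓ)) :
    (alphaParam hr Φ = 1 ↔ gammaLeft hr Φ = -1) ∧ (alphaParam hr Φ = -1 ↔ gammaLeft hr Φ = 1) := by
  rw [alphaParam, neg_one_pow_half_of_mod_four_eq_two h, neg_one_mul, neg_inj, neg_eq_iff_eq_neg]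
  exact ⟨Circle.coe_re_eq_neg_one_iff _, Circle.coe_re_eq_one_iff _⟩

theorem betaParam_iff_of_mod_four_eq_zero (hs : 3 ≤ s) (h : s % 4 = 0)
    (Φ : UnitGainGraph (dumbbellGraph r s ℓ)) :
    (betaParam hs Φ = 1 ↔ gammaRight hs Φ = 1) ∧ (betaParam hs Φ = -1 ↔ gammaRight hs Φ = -1) := by
  rw [betaParam, neg_one_pow_half_of_mod_four_eq_zero h, one_mul]
  exact ⟨Circle.coe_re_eq_one_iff _, Circle.coe_re_eq_neg_one_iff _⟩

theorem betaParam_iff_of_mod_four_eq_two (hs : 3 ≤ s) (h : s % 4 = 2)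
    (Φ : UnitGainGraph (dumbbellGraph r s ℓ)) :
    (betaParam hs Φ = 1 ↔ gammaRight hs Φ = -1) ∧ (betaParam hs Φ = -1 ↔ gammaRight hs Φ = 1) := by
  rw [betaParam, neg_one_pow_half_of_mod_four_eq_two h, neg_one_mul, neg_inj, neg_eq_iff_eq_neg]
  exact ⟨Circle.coe_re_eq_neg_one_iff _, Circle.coe_re_eq_one_iff _⟩

/-- Monotonicity makes the corners optimal. Conversely, a gain graph off the corner is strictly
beaten by the realized corner, since one of its parameters differs strictly. -/
theorem dumbbell_extremal_energy (hr : 3 ≤ r) (hs : 3 ≤ s) (hℓ : 1 ≤ ℓ) (hre : Even r)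
    (hse : Even s) :
    (∃ Φ : UnitGainGraph (dumbbellGraph r s ℓ), IsMinEnergy Φ) ∧
      (∃ Φ : UnitGainGraph (dumbbellGraph r s ℓ), IsMaxEnergy Φ) ∧
      ∀ Φ : UnitGainGraph (dumbbellGraph r s ℓ),
        (IsMinEnergy Φ ↔ alphaParam hr Φ = 1 ∧ betaParam hs Φ = 1) ∧
        (IsMaxEnergy Φ ↔ alphaParam hr Φ = -1 ∧ betaParam hs Φ = -1) := by
  obtain ⟨m, rfl⟩ : ∃ m, r = m + 2 := ⟨r - 2, by omega⟩
  obtain ⟨n, rfl⟩ : ∃ n, s = n + 2 := ⟨s - 2, by omega⟩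
  obtain ⟨c, rfl⟩ : ∃ c, ℓ = c + 1 := ⟨ℓ - 1, by omega⟩
  have hme : Even m := by simpa [Nat.even_add] using hre
  have hne : Even n := by simpa [Nat.even_add] using hse
  have hmin (Φ : UnitGainGraph (dumbbellGraph (m + 2) (n + 2) (c + 1)))
      (h : alphaParam hr Φ = 1 ∧ betaParam hs Φ = 1) : IsMinEnergy Φ := fun Ψ =>
    energy_le_of_params_le hr hs hme hne
      (h.1 ▸ le_of_abs_le (abs_alphaParam_le_one hr Ψ))
      (h.2 ▸ le_of_abs_le (abs_betaParam_le_one hs Ψ))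
  have hmax (Φ : UnitGainGraph (dumbbellGraph (m + 2) (n + 2) (c + 1)))
      (h : alphaParam hr Φ = -1 ∧ betaParam hs Φ = -1) : IsMaxEnergy Φ := fun Ψ =>
    energy_le_of_params_le hr hs hme hne
      (h.1 ▸ (abs_le.1 (abs_alphaParam_le_one hr Ψ)).1)
      (h.2 ▸ (abs_le.1 (abs_betaParam_le_one hs Ψ)).1)
  obtain ⟨Φ₁, hα₁, hβ₁⟩ := exists_alphaParam_betaParam (c + 1) hr hs
    (Or.inl (rfl : (1 : ℝ) = 1)) (Or.inl (rfl : (1 : ℝ) = 1))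
  obtain ⟨Φ₂, hα₂, hβ₂⟩ := exists_alphaParam_betaParam (c + 1) hr hs
    (Or.inr (rfl : (-1 : ℝ) = -1)) (Or.inr (rfl : (-1 : ℝ) = -1))
  refine ⟨⟨Φ₁, hmin Φ₁ ⟨hα₁, hβ₁⟩⟩, ⟨Φ₂, hmax Φ₂ ⟨hα₂, hβ₂⟩⟩, fun Φ => ⟨⟨fun h => ?_, hmin Φ⟩,
    ⟨fun h => ?_, hmax Φ⟩⟩⟩
  · by_contra hcon
    have ha := le_of_abs_le (abs_alphaParam_le_one hr Φ)
    have hb := le_of_abs_le (abs_betaParam_le_one hs Φ)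
    refine (h Φ₁).not_gt (energy_lt_of_params_lt hr hs hme hne (ha.trans_eq hα₁.symm)
      (hb.trans_eq hβ₁.symm) ?_)
    rw [hα₁, hβ₁]
    rcases not_and_or.1 hcon with h' | h'
    · exact Or.inl (ha.lt_of_ne h')
    · exact Or.inr (hb.lt_of_ne h')
  · by_contra hcon
    have ha := (abs_le.1 (abs_alphaParam_le_one hr Φ)).1
    have hb := (abs_le.1 (abs_betaParam_le_one hs Φ)).1
    refine (h Φ₂).not_gt (energy_lt_of_params_lt hr hs hme hne (hα₂.trans_le ha)
      (hβ₂.trans_le hb) ?_)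
    rw [hα₂, hβ₂]
    rcases not_and_or.1 hcon with h' | h'
    · exact Or.inl (ha.lt_of_ne' h')
    · exact Or.inr (hb.lt_of_ne' h')

end Extremal

end DumbbellExtremal

theorem mainTheorem2 (r s ℓ : ℕ) (hr : 3 ≤ r) (hs : 3 ≤ s) (hℓ : 1 ≤ ℓ)
    (hre : Even r) (hse : Even s) :
    -- the minimum and the maximum are attained, exactly at (1, 1) and (-1, -1) respectively
    ((∃ Φ : UnitGainGraph (dumbbellGraph r s ℓ), IsMinEnergy Φ) ∧
      (∃ Φ : UnitGainGraph (dumbbellGraph r s ℓ), IsMaxEnergy Φ) ∧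
      ∀ Φ : UnitGainGraph (dumbbellGraph r s ℓ),
        (IsMinEnergy Φ ↔ alphaParam hr Φ = 1 ∧ betaParam hs Φ = 1) ∧
        (IsMaxEnergy Φ ↔ alphaParam hr Φ = -1 ∧ betaParam hs Φ = -1)) ∧
    -- the extremal cycle gains according to the residues of r and s mod 4
    (r % 4 = 0 → s % 4 = 0 → ∀ Φ : UnitGainGraph (dumbbellGraph r s ℓ),
        (IsMinEnergy Φ ↔ gammaLeft hr Φ = 1 ∧ gammaRight hs Φ = 1) ∧
        (IsMaxEnergy Φ ↔ gammaLeft hr Φ = -1 ∧ gammaRight hs Φ = -1)) ∧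
    (r % 4 = 2 → s % 4 = 2 → ∀ Φ : UnitGainGraph (dumbbellGraph r s ℓ),
        (IsMinEnergy Φ ↔ gammaLeft hr Φ = -1 ∧ gammaRight hs Φ = -1) ∧
        (IsMaxEnergy Φ ↔ gammaLeft hr Φ = 1 ∧ gammaRight hs Φ = 1)) ∧
    (r % 4 = 0 → s % 4 = 2 → ∀ Φ : UnitGainGraph (dumbbellGraph r s ℓ),
        (IsMinEnergy Φ ↔ gammaLeft hr Φ = 1 ∧ gammaRight hs Φ = -1) ∧
        (IsMaxEnergy Φ ↔ gammaLeft hr Φ = -1 ∧ gammaRight hs Φ = 1)) ∧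
    (r % 4 = 2 → s % 4 = 0 → ∀ Φ : UnitGainGraph (dumbbellGraph r s ℓ),
        (IsMinEnergy Φ ↔ gammaLeft hr Φ = -1 ∧ gammaRight hs Φ = 1) ∧
        (IsMaxEnergy Φ ↔ gammaLeft hr Φ = 1 ∧ gammaRight hs Φ = -1)) := by
  have main := dumbbell_extremal_energy hr hs hℓ hre hse
  refine ⟨main, fun h h' Φ => ?_, fun h h' Φ => ?_, fun h h' Φ => ?_, fun h h' Φ => ?_⟩
  · obtain ⟨a, a'⟩ := alphaParam_iff_of_mod_four_eq_zero hr h Φ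
    obtain ⟨b, b'⟩ := betaParam_iff_of_mod_four_eq_zero hs h' Φ
    rw [← a, ← a', ← b, ← b']
    exact main.2.2 Φ
  · obtain ⟨a, a'⟩ := alphaParam_iff_of_mod_four_eq_two hr h Φ
    obtain ⟨b, b'⟩ := betaParam_iff_of_mod_four_eq_two hs h' Φ
    rw [← a, ← a', ← b, ← b']
    exact main.2.2 Φ
  · obtain ⟨a, a'⟩ := alphaParam_iff_of_mod_four_eq_zero hr h Φ
    obtain ⟨b, b'⟩ := betaParam_iff_of_mod_four_eq_two hs h' Φ
    rw [← a, ← a', ← b, ← b']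
    exact main.2.2 Φ
  · obtain ⟨a, a'⟩ := alphaParam_iff_of_mod_four_eq_two hr h Φ
    obtain ⟨b, b'⟩ := betaParam_iff_of_mod_four_eq_zero hs h' Φ
    rw [← a, ← a', ← b, ← b']
    exact main.2.2 Φ
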